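/- Let $\mathcal F|\mathbb F_q$ be an algebraic function field in one variable (of arbitrary genus), and let $\mathcal H_1,\dots,\mathcal H_s$ ($s\ge 1$) be nontrivial subgroups of $\mathrm{Aut}(\mathcal F|\mathbb F_q)$ such that (i) the product set $\mathcal G=\mathcal H_1\mathcal H_2\cdots\mathcal H_s$ is a group; (ii) $\#\bigl(\mathcal H_i\setminus(\{1\}\cup\bigcup_{j<i}\mathcal H_j)\bigr)=r_i$ for $i=1,\dots,s$. Let $\mathcal P=\{P_1,\dots,P_n\}$ ($n$ distinct places) be the set of all places of $\mathcal F$ lying over the members of a set of rational places of the fixed field $\mathcal F^{\mathcal G}$ that are completely split in $\mathcal F|\mathcal F^{\mathcal G}$ (a place $Q$ is completely split if there are exactly $[\mathcal F:\mathcal F^{\mathcal G}]$ places of $\mathcal F$ over it, all rational). Let $P_\infty$ be a rational place of $\mathcal F$ that is totally ramified in $\mathcal F|\mathcal F^{\mathcal G}$ (its ramification index is $[\mathcal F:\mathcal F^{\mathcal G}]$), and let $Q^{(i)}_\infty$ be the place of $\mathcal F^{\mathcal H_i}$ lying under $P_\infty$. Suppose that for $i=1,\dots,s$ there are functions $z_i,w_i$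 such that, $(f)_\infty$ denoting the pole divisor of $f$ and $P^{\mathcal H_i}$ the orbit of $P$ under $\mathcal H_i$, (iii) $z_i\in\mathcal F^{\mathcal H_i}$ and $\mathrm{supp}((z_i)_\infty)=\{Q^{(i)}_\infty\}$; (iv) $w_i\in\mathcal F\setminus\mathcal F^{\mathcal H_i}$ and $\mathrm{supp}((w_i)_\infty)=\{P_\infty\}$; (v) for every $P\in\mathcal P$ the map $P^{\mathcal H_i}\to\mathbb F_q$, $P'\mapsto w_i(P')$, is injective. Let $1\le d\le n$ and let $t_i\ge 1$ be integers such that for every $i$ $$V_i:=\Bigl\{\sum_{\ell=0}^{r_i-1}\Bigl(\sum_{j=0}^{t_i}a_{\ell j}z_i^j\Bigr)w_i^\ell \;:\; a_{\ell j}\in\mathbb F_q\Bigr\}\subseteq\mathcal L((n-d)P_\infty),$$ where $\mathcal L(D)$ is the Riemann–Roch space of the divisor $D$, and put $V=\bigcap_{i=1}^s V_i$. If $\dim_{\mathbb F_q}V>0$, then the code $\mathcal C=\{(f(P_1),\dots,f(P_n)) : f\in V\}\subseteq\mathbb F_q^n$ is an $[n,\dim_{\mathbb F_q}V,\ge d;\,r_1,\dots,r_s]$-recoverable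 code; that is, $\mathcal C$ is linear of length $n$ and dimension $k=\dim_{\mathbb F_q}V$, any two distinct codewords differ in at least $d$ coordinates, and, if $g_1,\dots,g_n$ are the columns of a generator matrix of $\mathcal C$, then for every $a\in\{1,\dots,n\}$ there are pairwise disjoint sets $R_1,\dots,R_s\subseteq\{1,\dots,n\}\setminus\{a\}$ with $\#R_i=r_i$ and $g_a\in\langle g_b : b\in R_i\rangle$ for $i=1,\dots,s$. Moreover, for every generator matrix of $\mathcal C$ one may take for $R_i$ the set of all $b\ne a$ such that $P_b$ and $P_a$ lie over the same place of $\mathcal F^{\mathcal H_i}$ but over different places of $\mathcal F^{\mathcal H_j}$ for every $j<i$. -/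

import Mathlib

open scoped Pointwise

/-- `F | K` is an algebraic function field in one variable. -/
def IsFunctionField (K F : Type*) [Field K] [Field F] [Algebra K F] : Prop :=
  ∃ x : F, Transcendental K x ∧ FiniteDimensional (IntermediateField.adjoin K {x}) F

/-- A place of `F | K`, given by its valuation ring `𝒪` with `K ⊆ 𝒪 ⊊ F`. (For a function field
the other properness condition `K ≠ 𝒪` is automatic, `F` being the fraction field of `𝒪`.) -/
@[ext]
structure Place (K F : Type*) [Field K] [Field F] [Algebra K F] where
  ring : ValuationSubring F
  algebraMap_mem : ∀ a : K, algebraMap K F a ∈ ring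
  ne_top : ring ≠ ⊤

namespace Place

section

variable {K F : Type*} [Field K] [Field F] [Algebra K F]

/-- `f` is regular at `P` and `f(P) = a`, that is, `f - a` lies in the maximal ideal of `P`. -/
def HasValue (P : Place K F) (f : F) (a : K) : Prop :=
  f - algebraMap K F a ∈ P.ring.nonunits

/-- `P` is rational: the residue field of `P` is `K`. -/
def IsRational (P : Place K F) : Prop :=
  ∀ f ∈ P.ring, ∃ a : K, P.HasValue f a

/-- The support of the pole divisor of `f`. -/
def poles (K : Type*) {F : Type*} [Field K] [Field F] [Algebra K F] (f : F) : Set (Place K F) :=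
  {P | f ∉ P.ring}

/-- `t` generates the maximal ideal of `P`. -/
def IsUniformizer (P : Place K F) (t : F) : Prop :=
  t ≠ 0 ∧ t ∈ P.ring.nonunits ∧ ∀ u ∈ P.ring.nonunits, u / t ∈ P.ring

/-- `v_P(f) ≥ m` for the normalized discrete valuation `v_P` (with `v_P(0) = ∞`):
`f / t ^ m` is regular at `P` for a uniformizer `t`. -/
def OrdGE (P : Place K F) (f : F) (m : ℤ) : Prop :=
  ∃ t, P.IsUniformizer t ∧ f / t ^ m ∈ P.ring

/-- The Riemann-Roch space `ℒ(D)` of a divisor `D`. -/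
def riemannRoch (D : Place K F →₀ ℤ) : Set F :=
  {f | ∀ P : Place K F, P.OrdGE f (-(D P))}

/-- The orbit of the place `P` under a group `H` of automorphisms. -/
def orbit (H : Subgroup (F ≃ₐ[K] F)) (P : Place K F) : Set (Place K F) :=
  {P' | ∃ σ ∈ H, ∀ f : F, f ∈ P.ring ↔ σ f ∈ P'.ring}

end

section

variable {K L F : Type*} [Field K] [Field L] [Field F] [Algebra K L] [Algebra K F] [Algebra L F]

/-- `P` lies over `Q`: the valuation ring of `Q` is the trace on `L` of the one of `P`. -/
def LiesOver (P : Place K F) (Q : Place K L) : Prop :=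
  ∀ x : L, x ∈ Q.ring ↔ algebraMap L F x ∈ P.ring

/-- `P` lies over `Q` with `e(P|Q) = e`: a uniformizer of `Q` is a unit times the `e`-th power
of a uniformizer of `P`. -/
def HasRamificationIndex (P : Place K F) (Q : Place K L) (e : ℕ) : Prop :=
  P.LiesOver Q ∧ ∃ (t : F) (u : L), P.IsUniformizer t ∧ Q.IsUniformizer u ∧
    algebraMap L F u / t ^ e ∈ P.ring ∧ t ^ e / algebraMap L F u ∈ P.ring

variable (L) in
/-- `P` is totally ramified in `F | L`: its ramification index over `L` is `[F : L]`. -/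
def IsTotallyRamified (P : Place K F) : Prop :=
  ∃ Q : Place K L, P.HasRamificationIndex Q (Module.finrank L F)

variable (F) in
/-- `Q` is completely split in `F | L`: there are `[F : L]` places of `F` over `Q`,
all of them rational. -/
def IsCompletelySplit (Q : Place K L) : Prop :=
  {P : Place K F | P.LiesOver Q}.encard = Module.finrank L F ∧
    ∀ P : Place K F, P.LiesOver Q → P.IsRational

variable (L) in
/-- `P` and `P'` lie over the same place of `L`. -/
def SameUnder (P P' : Place K F) : Prop :=
  ∀ x : L, algebraMap L F x ∈ P.ring ↔ algebraMap L F x ∈ P'.ring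

end

end Place

section Codes

variable {K : Type*} [Field K] {k n s : ℕ}

/-- The rows of `M` form a basis of the linear code `C`. -/
def IsGeneratorMatrix (M : Matrix (Fin k) (Fin n) K) (C : Submodule K (Fin n → K)) : Prop :=
  LinearIndependent K M.row ∧ Submodule.span K (Set.range M.row) = C

/-- `R` consists of pairwise disjoint repair sets, of sizes `r`, for the coordinate `a` of the code
with generator matrix `M`. -/
def IsRepairFamily (M : Matrix (Fin k) (Fin n) K) (r : Fin s → ℕ) (a : Fin n)
    (R : Fin s → Set (Fin n)) : Prop :=
  (∀ i j, i ≠ j → Disjoint (R i) (R j)) ∧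
    ∀ i, a ∉ R i ∧ (R i).ncard = r i ∧ M.col a ∈ Submodule.span K (M.col '' R i)

/-- `C` is an `[n, k, ≥ d; r₁, …, r_s]`-recoverable code. -/
def IsRecoverableCode (C : Submodule K (Fin n → K)) (k d : ℕ) (r : Fin s → ℕ) : Prop :=
  (∀ c ∈ C, ∀ c' ∈ C, c ≠ c' → d ≤ {a | c a ≠ c' a}.ncard) ∧
    ∃ M : Matrix (Fin k) (Fin n) K, IsGeneratorMatrix M C ∧
      ∀ a, ∃ R : Fin s → Set (Fin n), IsRepairFamily M r a R

end Codes

section Construction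

variable {K F : Type*} [Field K] [Field F] [Algebra K F]

/-- The space of all `∑_{ℓ < r} (∑_{j ≤ t} a_{ℓ j} z ^ j) w ^ ℓ` with `a_{ℓ j} ∈ K`. -/
def functionSpace (K : Type*) {F : Type*} [Field K] [Field F] [Algebra K F]
    (r t : ℕ) (z w : F) : Submodule K F where
  carrier := {f | ∃ a : ℕ → ℕ → K,
    f = ∑ l ∈ Finset.range r, (∑ j ∈ Finset.range (t + 1), a l j • z ^ j) * w ^ l}
  zero_mem' := ⟨0, by simp⟩
  add_mem' := by
    rintro _ _ ⟨a, rfl⟩ ⟨b, rfl⟩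
    exact ⟨a + b, by simp [add_smul, add_mul, Finset.sum_add_distrib]⟩
  smul_mem' := by
    rintro c _ ⟨a, rfl⟩
    exact ⟨c • a, by simp only [Finset.smul_sum, Pi.smul_apply, smul_eq_mul, mul_smul, ← smul_mul_assoc]⟩

/-- The code of all words `(f(P₁), …, f(Pₙ))` with `f ∈ V` regular at all the `P_a`. -/
def evalCode {n : ℕ} (P : Fin n → Place K F) (V : Submodule K F) : Submodule K (Fin n → K) where
  carrier := {c | ∃ f ∈ V, ∀ a, (P a).HasValue f (c a)}
  zero_mem' := ⟨0, V.zero_mem, fun a => by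
    simp [Place.HasValue]⟩
  add_mem' := by
    rintro c c' ⟨f, hf, h⟩ ⟨g, hg, h'⟩
    refine ⟨f + g, V.add_mem hf hg, fun a => ?_⟩
    have := (P a).ring.nonunits.add_mem (h a) (h' a)
    simpa [Place.HasValue, add_sub_add_comm] using this
  smul_mem' := by
    rintro b c ⟨f, hf, h⟩
    refine ⟨b • f, V.smul_mem b hf, fun a => ?_⟩
    have h1 : (P a).ring.valuation (f - algebraMap K F (c a)) < 1 := h a
    have h2 := ((P a).ring.valuation_le_one_iff _).2 ((P a).algebraMap_mem b)
    change (P a).ring.valuation _ < 1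
    have : b • f - algebraMap K F ((b • c) a)
        = algebraMap K F b * (f - algebraMap K F (c a)) := by
      simp [Algebra.smul_def, mul_sub]
    rw [this, map_mul]
    exact (mul_le_of_le_one_left' h2).trans_lt h1

/-- The indices of the places `≠ P_a` in the fibre of `P_a` over `F^{H_i}`, but in none of its
fibres over `F^{H_j}`, `j < i`. -/
def fibreRepairSet {n s : ℕ} (H : Fin s → Subgroup (F ≃ₐ[K] F)) (P : Fin n → Place K F)
    (a : Fin n) (i : Fin s) : Set (Fin n) :=
  {b | b ≠ a ∧ Place.SameUnder (IntermediateField.fixedField (H i)) (P a) (P b) ∧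
    ∀ j < i, ¬ Place.SameUnder (IntermediateField.fixedField (H j)) (P a) (P b)}

end Construction

/-!
The automorphisms of `F | K` act on the places of `F | K`. A finite group `H` of them acts
transitively on the places over a given place of its fixed field
(`Place.SameUnder.exists_smul_eq`). Over a completely split place it acts freely, by counting
(`Place.IsCompletelySplit.eq_of_smul_eq`); over a totally ramified place a nontrivial group does not
(`Place.IsTotallyRamified.exists_smul_eq`). Both facts about fibres come from the norm of a function
provided by weak approximation, which in turn rests on places being archimedean, the function field
having transcendence degree one. In particular no `P_a` is conjugate to the place at infinity, so
`z_i` and `w_i` are regular at all `P_a`.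

By freeness, the fibre of `P_a` over the fixed field of `H_i`, without `P_a` and the fibres for
`j < i`, is in bijection with `H_i \ ({1} ∪ ⋃ j < i, H_j)`, so it has `r_i` elements. On that fibre
`z_i` is constant and `w_i` is injective, and a function in `V_i` is a polynomial in `w_i` of degree
less than `r_i`. Lagrange interpolation recovers its value at `P_a` from the other values
(`col_mem_span_of_functionSpace`).

The distance and the dimension of the code follow from the fact that a nonzero function in
`ℒ(m P∞)` has at most `m` zeros (`Place.card_zeros_le`): if it has `N` zeros, then
there are `N` functions `g_j` independent over `K[f]` with poles only at `P∞`; the products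
`f ^ i * g_j`, `i ≤ k`, are `(k + 1) N` independent elements of a space `ℒ((m k + c) P∞)`, which has
dimension at most `m k + c + 1`, so that `N ≤ m` for `k → ∞`.
-/

/-! ### Places as maximal subrings -/

section FunctionField

variable {K F : Type*} [Field K] [Field F] [Algebra K F]

theorem IsFunctionField.isAlgebraic_adjoin (hF : IsFunctionField K F) {y : F}
    (hy : Transcendental K y) : Algebra.IsAlgebraic (Algebra.adjoin K {y}) F := by
  obtain ⟨x, hx, hfin⟩ := hF
  have h1 : Algebra.IsAlgebraic (Algebra.adjoin K {x}) F := by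
    open scoped IntermediateField.algebraAdjoinAdjoin in
    exact (IsFractionRing.comap_isAlgebraic_iff (A := Algebra.adjoin K {x})
      (K := IntermediateField.adjoin K {x}) (C := F)).2 inferInstance
  have hle : Algebra.trdeg K F ≤ 1 := by
    have := Algebra.IsAlgebraic.trdeg_le_cardinalMk K ({x} : Set F)
    simpa using this
  have hind : AlgebraicIndependent K (fun _ : Unit => y) :=
    algebraicIndependent_unique_type_iff.2 hy
  have hb : IsTranscendenceBasis K (fun _ : Unit => y) :=
    hind.isTranscendenceBasis_of_lift_trdeg_le_of_finite (by simpa using hle)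
  have := hb.isAlgebraic
  rwa [Set.range_const] at this

end FunctionField

namespace Place

variable {K F : Type*} [Field K] [Field F] [Algebra K F]

theorem aeval_mem (P : Place K F) {y : F} (hy : y ∈ P.ring) (p : Polynomial K) :
    Polynomial.aeval y p ∈ P.ring := by
  rw [Polynomial.aeval_eq_sum_range]
  refine sum_mem fun i _ => ?_
  rw [Algebra.smul_def]
  exact mul_mem (P.algebraMap_mem _) (pow_mem hy _)

theorem valuation_algebraMap (P : Place K F) {a : K} (ha : a ≠ 0) :
    P.ring.valuation (algebraMap K F a) = 1 := by
  refine le_antisymm ((P.ring.valuation_le_one_iff _).2 (P.algebraMap_mem a)) ?_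
  have h := (P.ring.valuation_le_one_iff _).2 (P.algebraMap_mem a⁻¹)
  rw [map_inv₀, map_inv₀] at h
  have h0 : P.ring.valuation (algebraMap K F a) ≠ 0 := by simpa using ha
  exact (inv_le_one₀ (zero_lt_iff.2 h0)).1 h

theorem valuation_aeval (P : Place K F) {y : F} (hy : y ∈ P.ring.nonunits) {p : Polynomial K}
    (hp : p.coeff 0 ≠ 0) : P.ring.valuation (Polynomial.aeval y p) = 1 := by
  rw [← p.divX_mul_X_add, map_add, map_mul, Polynomial.aeval_X, Polynomial.aeval_C]
  have h1 : P.ring.valuation (Polynomial.aeval y p.divX * y) < 1 := by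
    rw [map_mul]
    exact (mul_le_of_le_one_left' ((P.ring.valuation_le_one_iff _).2
      (P.aeval_mem (P.ring.nonunits_subset hy) _))).trans_lt hy
  have h2 := P.valuation_algebraMap hp
  rw [add_comm, Valuation.map_add_eq_of_lt_left, h2]
  rwa [h2]

theorem mem_of_isIntegral (P : Place K F) {A : Subalgebra K F} (hA : ∀ a ∈ A, a ∈ P.ring) {x : F}
    (hx : IsIntegral A x) : x ∈ P.ring := by
  obtain ⟨p, hp, hpx⟩ := hx
  have : IsIntegral P.ring x := by
    refine ⟨p.map ((algebraMap A F).codRestrict P.ring.toSubring fun a => hA a a.2), hp.map _, ?_⟩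
    rw [Polynomial.eval₂_map]
    exact hpx
  obtain ⟨y, rfl⟩ := IsIntegrallyClosed.isIntegral_iff.1 this
  exact y.2

theorem mem_of_isIntegral_adjoin (P : Place K F) {y x : F} (hy : y ∈ P.ring)
    (hx : IsIntegral (Algebra.adjoin K {y}) x) : x ∈ P.ring := by
  refine P.mem_of_isIntegral (fun a ha => ?_) hx
  rw [Algebra.adjoin_singleton_eq_range_aeval] at ha
  obtain ⟨p, rfl⟩ := ha
  exact P.aeval_mem hy p

theorem transcendental_of_mem_nonunits (P : Place K F) {y : F} (hy : y ∈ P.ring.nonunits)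
    (h0 : y ≠ 0) : Transcendental K y := by
  intro halg
  have h1 : y⁻¹ ∈ P.ring := by
    refine P.mem_of_isIntegral (A := ⊥) ?_ (IsIntegral.tower_top (R := K) halg.inv.isIntegral)
    rintro _ ⟨a, rfl⟩
    exact P.algebraMap_mem a
  rcases P.ring.mem_nonunits_iff_or.1 hy with h | h
  exacts [h0 h, h h1]

/-- Places are archimedean: since `F` is algebraic over `K(y)`, some nonzero multiple `p(y) x` with
`p ∈ K[X]` is integral over `K[y]`, and `p(y)` is a unit times a power of `y`. -/
theorem exists_pow_mul_mem (hF : IsFunctionField K F) (P : Place K F) {y : F}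
    (hy : y ∈ P.ring.nonunits) (h0 : y ≠ 0) (x : F) : ∃ k : ℕ, y ^ k * x ∈ P.ring := by
  have htr := P.transcendental_of_mem_nonunits hy h0
  have := hF.isAlgebraic_adjoin htr
  obtain ⟨⟨c, hc⟩, hc0, hint⟩ :=
    (Algebra.IsAlgebraic.isAlgebraic (R := Algebra.adjoin K {y}) x).exists_integral_multiple
  have hcx : c * x ∈ P.ring := P.mem_of_isIntegral_adjoin (P.ring.nonunits_subset hy) hint
  rw [Algebra.adjoin_singleton_eq_range_aeval] at hc
  obtain ⟨p, rfl⟩ := hc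
  have hp0 : p ≠ 0 := by
    rintro rfl
    exact hc0 (by ext; simp)
  obtain ⟨q, hq, hq0⟩ := Polynomial.exists_eq_pow_rootMultiplicity_mul_and_not_dvd p hp0 0
  refine ⟨p.rootMultiplicity 0, ?_⟩
  have hq1 : q.coeff 0 ≠ 0 := by
    rwa [map_zero, sub_zero, Polynomial.X_dvd_iff] at hq0
  rw [← P.ring.valuation_le_one_iff] at hcx ⊢
  simp only [AlgHom.toRingHom_eq_coe, RingHom.coe_coe] at hcx
  rw [hq, map_zero, sub_zero, map_mul, map_mul, map_pow, Polynomial.aeval_X, map_mul,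
    P.valuation_aeval hy hq1, mul_one] at hcx
  rwa [map_mul]

theorem exists_forall_ge_pow_mul_mem_nonunits (hF : IsFunctionField K F) (P : Place K F) {y : F}
    (hy : y ∈ P.ring.nonunits) (x : F) :
    ∃ k₀ : ℕ, ∀ k, k₀ ≤ k → y ^ k * x ∈ P.ring.nonunits := by
  by_cases h0 : y = 0
  · refine ⟨1, fun k hk => ?_⟩
    rw [h0, zero_pow (by omega), zero_mul]
    exact zero_mem _
  obtain ⟨k, hk⟩ := P.exists_pow_mul_mem hF hy h0 x
  refine ⟨k + 1, fun l hl => ?_⟩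
  obtain ⟨j, rfl⟩ := Nat.exists_eq_add_of_le hl
  have e : y ^ (k + 1 + j) * x = y ^ j * (y ^ k * x) * y := by ring
  rw [e, ValuationSubring.mem_nonunits_iff, map_mul]
  refine (mul_le_of_le_one_left' ((P.ring.valuation_le_one_iff _).2 (mul_mem (pow_mem
    (P.ring.nonunits_subset hy) _) hk))).trans_lt hy

/-- The ring of a place is a maximal proper subring. -/
theorem eq_of_ring_le (hF : IsFunctionField K F) {P P' : Place K F} (h : P.ring ≤ P'.ring) :
    P = P' := by
  refine Place.ext (le_antisymm h fun x hx => ?_)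
  by_contra hxP
  refine P'.ne_top (eq_top_iff.2 fun f _ => ?_)
  have hx0 : x ≠ 0 := by
    rintro rfl
    exact hxP (zero_mem _)
  obtain ⟨k, hk⟩ := P.exists_pow_mul_mem hF
    (P.ring.inv_mem_nonunits_iff.2 (Or.inr hxP)) (inv_ne_zero hx0) f
  have : f = x ^ k * (x⁻¹ ^ k * f) := by
    rw [← mul_assoc, ← mul_pow, mul_inv_cancel₀ hx0, one_pow, one_mul]
  rw [this]
  exact mul_mem (pow_mem hx _) (h hk)

end Place

namespace Place

/-! ### Values of functions at places -/

section Values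

variable {K F : Type*} [Field K] [Field F] [Algebra K F] {P : Place K F}

theorem hasValue_zero_iff {f : F} : P.HasValue f 0 ↔ f ∈ P.ring.nonunits := by
  simp [HasValue]

theorem hasValue_algebraMap (P : Place K F) (a : K) : P.HasValue (algebraMap K F a) a := by
  simp [HasValue]

theorem HasValue.mem_ring {f : F} {a : K} (h : P.HasValue f a) : f ∈ P.ring := by
  have := add_mem (P.ring.nonunits_subset h) (P.algebraMap_mem a)
  simpa using this

theorem HasValue.unique {f : F} {a b : K} (h : P.HasValue f a) (h' : P.HasValue f b) : a = b := by
  by_contra hab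
  have h1 : P.ring.valuation (algebraMap K F (b - a)) < 1 := by
    have := P.ring.nonunits.sub_mem h h'
    rw [map_sub]
    rwa [sub_sub_sub_cancel_left] at this
  rw [P.valuation_algebraMap (sub_ne_zero.2 (Ne.symm hab))] at h1
  exact lt_irrefl _ h1

theorem HasValue.add {f g : F} {a b : K} (h : P.HasValue f a) (h' : P.HasValue g b) :
    P.HasValue (f + g) (a + b) := by
  have := P.ring.nonunits.add_mem h h'
  simpa [HasValue, add_sub_add_comm] using this

theorem mul_mem_nonunits {f g : F} (hf : f ∈ P.ring) (hg : g ∈ P.ring.nonunits) :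
    f * g ∈ P.ring.nonunits := by
  rw [ValuationSubring.mem_nonunits_iff, map_mul]
  exact (mul_le_of_le_one_left' ((P.ring.valuation_le_one_iff _).2 hf)).trans_lt hg

theorem HasValue.mul {f g : F} {a b : K} (h : P.HasValue f a) (h' : P.HasValue g b) :
    P.HasValue (f * g) (a * b) := by
  have e : f * g - algebraMap K F (a * b)
      = f * (g - algebraMap K F b) + algebraMap K F b * (f - algebraMap K F a) := by
    rw [map_mul]
    ring
  rw [HasValue, e]
  exact add_mem (mul_mem_nonunits h.mem_ring h') (mul_mem_nonunits (P.algebraMap_mem b) h)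

theorem HasValue.smul {f : F} {a : K} (c : K) (h : P.HasValue f a) :
    P.HasValue (c • f) (c * a) := by
  rw [Algebra.smul_def]
  exact (P.hasValue_algebraMap c).mul h

theorem HasValue.pow {f : F} {a : K} (h : P.HasValue f a) (k : ℕ) :
    P.HasValue (f ^ k) (a ^ k) := by
  induction k with
  | zero => simpa using P.hasValue_algebraMap 1
  | succ k ih => simpa only [pow_succ] using ih.mul h

theorem HasValue.sum {ι : Type*} {s : Finset ι} {f : ι → F} {a : ι → K}
    (h : ∀ i ∈ s, P.HasValue (f i) (a i)) : P.HasValue (∑ i ∈ s, f i) (∑ i ∈ s, a i) := by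
  classical
  induction s using Finset.induction_on with
  | empty => simpa using P.hasValue_algebraMap 0
  | insert i s hi ih =>
    rw [Finset.sum_insert hi, Finset.sum_insert hi]
    exact (h i (by simp)).add (ih fun j hj => h j (by simp [hj]))

theorem HasValue.prod_one {ι : Type*} {s : Finset ι} {f : ι → F}
    (h : ∀ i ∈ s, P.HasValue (f i) 1) : P.HasValue (∏ i ∈ s, f i) 1 := by
  classical
  induction s using Finset.induction_on with
  | empty => simpa using P.hasValue_algebraMap 1
  | insert i s hi ih =>
    rw [Finset.prod_insert hi]
    simpa using (h i (by simp)).mul (ih fun j hj => h j (by simp [hj]))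

theorem HasValue.valuation_eq_one {f : F} {a : K} (h : P.HasValue f a) (ha : a ≠ 0) :
    P.ring.valuation f = 1 := by
  have e : f = algebraMap K F a + (f - algebraMap K F a) := by ring
  have h1 := P.valuation_algebraMap ha
  rw [e, Valuation.map_add_eq_of_lt_left, h1]
  rw [h1]
  exact h

end Values

/-! ### Weak approximation -/

section WeakApproximation

variable {K F : Type*} [Field K] [Field F] [Algebra K F]

/-- Some function has a pole at `P₀` and zeros at the finitely many other given places. -/
theorem exists_one_lt_valuation (hF : IsFunctionField K F) (T : Finset (Place K F))
    {P₀ : Place K F} (h₀ : P₀ ∉ T) :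
    ∃ z : F, 1 < P₀.ring.valuation z ∧ ∀ P ∈ T, z ∈ P.ring.nonunits := by
  classical
  induction T using Finset.induction_on with
  | empty =>
    obtain ⟨z, -, hz⟩ := SetLike.exists_of_lt (lt_top_iff_ne_top.2 P₀.ne_top)
    exact ⟨z, lt_of_not_ge fun h => hz ((P₀.ring.valuation_le_one_iff _).1 h), by simp⟩
  | insert P' T hP' ih =>
    obtain ⟨z, hz, hzT⟩ := ih fun h => h₀ (by simp [h])
    have hne : P₀ ≠ P' := fun h => h₀ (by simp [h])
    obtain ⟨z', hz', hzP'⟩ : ∃ z' : F, 1 < P₀.ring.valuation z' ∧ z' ∈ P'.ring.nonunits := by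
      obtain ⟨x, hx, hx0⟩ := SetLike.not_le_iff_exists.1
        fun h : P'.ring ≤ P₀.ring => hne (eq_of_ring_le hF h).symm
      obtain ⟨y, hy, hy'⟩ := SetLike.not_le_iff_exists.1
        fun h : P₀.ring ≤ P'.ring => hne (eq_of_ring_le hF h)
      rw [← ValuationSubring.valuation_le_one_iff] at hx hx0 hy hy'
      rw [not_le] at hx0 hy'
      have hy0 : y ≠ 0 := by
        rintro rfl
        simp at hy'
      refine ⟨x / y, ?_, ?_⟩
      · rw [map_div₀, one_lt_div₀ (zero_lt_iff.2 (by simpa using hy0))]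
        exact hy.trans_lt hx0
      · rw [ValuationSubring.mem_nonunits_iff, map_div₀,
          div_lt_one₀ (zero_lt_iff.2 (by simpa using hy0))]
        exact hx.trans_lt hy'
    have hev : ∀ᶠ k : ℕ in Filter.atTop, 1 ≤ k ∧ ∀ P ∈ T, z ^ k * z' ∈ P.ring.nonunits := by
      refine (Filter.eventually_ge_atTop 1).and ((Filter.eventually_all_finset T).2 fun P hP => ?_)
      obtain ⟨k₀, hk⟩ := P.exists_forall_ge_pow_mul_mem_nonunits hF (hzT P hP) z'
      exact Filter.eventually_atTop.2 ⟨k₀, hk⟩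
    obtain ⟨k, hk1, hk⟩ := hev.exists
    have hk0 : k ≠ 0 := by omega
    by_cases hzz : z ∈ P'.ring
    · refine ⟨z ^ k * z', ?_, fun P hP => ?_⟩
      · rw [map_mul, map_pow]
        exact one_lt_mul_of_le_of_lt (one_le_pow₀ hz.le) hz'
      · rcases Finset.mem_insert.1 hP with rfl | hP
        · exact mul_mem_nonunits (pow_mem hzz k) hzP'
        · exact hk P hP
    · -- the factor `z ^ k / (1 + z ^ k)` is a unit at the poles of `z`
      rw [← ValuationSubring.valuation_le_one_iff, not_le] at hzz
      have hbig : ∀ P : Place K F, 1 < P.ring.valuation z →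
          P.ring.valuation (z ^ k / (1 + z ^ k)) = 1 := by
        intro P h
        have h1 : P.ring.valuation (1 + z ^ k) = P.ring.valuation (z ^ k) := by
          apply Valuation.map_add_eq_of_lt_right
          rw [map_one, map_pow]
          exact one_lt_pow₀ h hk0
        rw [map_div₀, h1, div_self]
        rw [map_pow]
        exact pow_ne_zero _ (zero_lt_one.trans h).ne'
      have hsmall : ∀ P : Place K F, z ∈ P.ring.nonunits →
          P.ring.valuation (1 + z ^ k) = 1 := by
        intro P h
        rw [Valuation.map_add_eq_of_lt_left, map_one]
        rw [map_one, map_pow]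
        exact pow_lt_one₀ zero_le h hk0
      refine ⟨z ^ k / (1 + z ^ k) * z', ?_, fun P hP => ?_⟩
      · rwa [map_mul, hbig _ hz, one_mul]
      · rcases Finset.mem_insert.1 hP with rfl | hP
        · rwa [ValuationSubring.mem_nonunits_iff, map_mul, hbig _ hzz, one_mul]
        · rw [div_mul_eq_mul_div, ValuationSubring.mem_nonunits_iff, map_div₀,
            hsmall P (hzT P hP), div_one]
          exact hk P hP

/-- Weak approximation of the values `0` and `1`. -/
theorem exists_hasValue_one_zero (hF : IsFunctionField K F) {A B : Finset (Place K F)}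
    (hAB : Disjoint A B) :
    ∃ f : F, (∀ P ∈ A, P.HasValue f 1) ∧ ∀ P ∈ B, P.HasValue f 0 := by
  classical
  have key : ∀ (T : Finset (Place K F)) (P₀ : Place K F), ∃ f : F, P₀.HasValue f 1 ∧
      ∀ P ∈ T, P ≠ P₀ → P.HasValue f 0 := by
    intro T P₀
    obtain ⟨z, hz, hT⟩ := exists_one_lt_valuation hF (T.erase P₀) (Finset.notMem_erase P₀ T)
    have h1 : P₀.ring.valuation (1 + z) = P₀.ring.valuation z := by
      apply Valuation.map_add_eq_of_lt_right
      rwa [map_one]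
    have h2 : (1 + z) ≠ 0 := by
      intro h
      rw [h, map_zero] at h1
      rw [← h1] at hz
      exact not_lt_zero hz
    refine ⟨z / (1 + z), ?_, fun P hP hne => ?_⟩
    · have e : z / (1 + z) - algebraMap K F 1 = -(1 + z)⁻¹ := by
        rw [map_one]
        field_simp
        ring
      rw [HasValue, e, ValuationSubring.mem_nonunits_iff, Valuation.map_neg, map_inv₀, h1]
      exact inv_lt_one_of_one_lt₀ hz
    · have h := hT P (by simp [hP, hne])
      rw [hasValue_zero_iff, ValuationSubring.mem_nonunits_iff, map_div₀,
        Valuation.map_add_eq_of_lt_left, map_one, div_one]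
      · exact h
      · rw [map_one]
        exact h
  choose e he1 he0 using key (A ∪ B)
  refine ⟨∑ P ∈ A, e P, fun P hP => ?_, fun P hP => ?_⟩
  · rw [← Finset.add_sum_erase A e hP]
    have : P.HasValue (∑ Q ∈ A.erase P, e Q) (∑ Q ∈ A.erase P, (0 : K)) :=
      HasValue.sum fun Q hQ => he0 Q P (by simp [hP]) (Finset.ne_of_mem_erase hQ).symm
    simpa using (he1 P).add this
  · have : P.HasValue (∑ Q ∈ A, e Q) (∑ Q ∈ A, (0 : K)) :=
      HasValue.sum fun Q hQ => he0 Q P (by simp [hP])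
        fun h => Finset.disjoint_left.1 hAB hQ (h ▸ hP)
    simpa using this

end WeakApproximation

/-! ### Automorphisms and fibres over fixed fields -/

section Action

variable {K F : Type*} [Field K] [Field F] [Algebra K F]

/-- Automorphisms of `F | K` act on its places through the action on valuation rings. -/
instance : MulAction (F ≃ₐ[K] F) (Place K F) where
  smul σ P :=
    { ring := σ • P.ring
      algebraMap_mem := fun a => (ValuationSubring.mem_smul_pointwise_iff_exists _ _ _).2
        ⟨algebraMap K F a, P.algebraMap_mem a, σ.commutes a⟩
      ne_top := fun h => P.ne_top <| eq_top_iff.2 fun x _ => by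
        have : σ x ∈ σ • P.ring := h ▸ ValuationSubring.mem_top _
        rw [ValuationSubring.mem_pointwise_smul_iff_inv_smul_mem] at this
        simpa [AlgEquiv.smul_def] using this }
  one_smul P := Place.ext (one_smul _ P.ring)
  mul_smul σ τ P := Place.ext (mul_smul σ τ P.ring)

theorem mem_smul_ring {σ : F ≃ₐ[K] F} {P : Place K F} {f : F} :
    f ∈ (σ • P).ring ↔ σ⁻¹ f ∈ P.ring :=
  ValuationSubring.mem_pointwise_smul_iff_inv_smul_mem

theorem mem_smul_nonunits {σ : F ≃ₐ[K] F} {P : Place K F} {f : F} :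
    f ∈ (σ • P).ring.nonunits ↔ σ⁻¹ f ∈ P.ring.nonunits := by
  simp only [ValuationSubring.mem_nonunits_iff_or, mem_smul_ring, map_inv₀, map_eq_zero_iff _
    (σ⁻¹ : F ≃ₐ[K] F).injective]

theorem hasValue_smul {σ : F ≃ₐ[K] F} {P : Place K F} {f : F} {a : K} :
    (σ • P).HasValue f a ↔ P.HasValue (σ⁻¹ f) a := by
  rw [HasValue, mem_smul_nonunits, map_sub, AlgEquiv.commutes, HasValue]

theorem mem_orbit_iff {H : Subgroup (F ≃ₐ[K] F)} {P P' : Place K F} :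
    P' ∈ orbit H P ↔ ∃ σ ∈ H, σ • P = P' := by
  refine exists_congr fun σ => and_congr_right fun _ => ⟨fun h => ?_, ?_⟩
  · refine Place.ext (SetLike.ext fun f => ?_)
    rw [mem_smul_ring, h, ← AlgEquiv.mul_apply, mul_inv_cancel, AlgEquiv.one_apply]
  · rintro rfl f
    rw [mem_smul_ring, ← AlgEquiv.mul_apply, inv_mul_cancel, AlgEquiv.one_apply]

theorem prod_mem_fixedField (H : Subgroup (F ≃ₐ[K] F)) [Fintype H] (f : F) :
    ∏ σ : H, (σ : F ≃ₐ[K] F) f ∈ IntermediateField.fixedField H := by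
  intro τ
  change (τ : F ≃ₐ[K] F) _ = _
  rw [map_prod]
  exact Fintype.prod_equiv (Equiv.mulLeft τ) _ _ fun σ => rfl

theorem sameUnder_smul {H : Subgroup (F ≃ₐ[K] F)} {σ : F ≃ₐ[K] F} (hσ : σ ∈ H) (P : Place K F) :
    SameUnder (IntermediateField.fixedField H) P (σ • P) := by
  intro x
  rw [mem_smul_ring]
  have : σ⁻¹ (x : F) = x := x.2 ⟨σ⁻¹, inv_mem hσ⟩
  change (x : F) ∈ P.ring ↔ σ⁻¹ (x : F) ∈ P.ring
  rw [this]

theorem SameUnder.mem_nonunits {L : Type*} [Field L] [Algebra L F] {P P' : Place K F}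
    (h : SameUnder L P P') (x : L) :
    algebraMap L F x ∈ P.ring.nonunits ↔ algebraMap L F x ∈ P'.ring.nonunits := by
  simp only [ValuationSubring.mem_nonunits_iff_or, ← map_inv₀, h x⁻¹]

/-- A finite group acts transitively on the places over a place of its fixed field. Otherwise the
norm of a function with value `0` on the orbit of `P` and `1` on the orbit of `P'` would be
a unit at only one of the two places. -/
theorem SameUnder.exists_smul_eq (hF : IsFunctionField K F) {H : Subgroup (F ≃ₐ[K] F)} [Finite H]
    {P P' : Place K F} (h : SameUnder (IntermediateField.fixedField H) P P') :
    ∃ σ ∈ H, σ • P = P' := by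
  classical
  by_contra! hne
  let _ := Fintype.ofFinite H
  let A : Finset (Place K F) := Finset.univ.image fun σ : H => (σ : F ≃ₐ[K] F) • P'
  let B : Finset (Place K F) := Finset.univ.image fun σ : H => (σ : F ≃ₐ[K] F) • P
  have hAB : Disjoint A B := by
    rw [Finset.disjoint_left]
    intro Q hA hB
    simp only [A, B, Finset.mem_image, Finset.mem_univ, true_and] at hA hB
    obtain ⟨σ, rfl⟩ := hA
    obtain ⟨τ, hτ⟩ := hB
    exact hne (σ⁻¹ * τ : H) (σ⁻¹ * τ : H).2 (by simp [mul_smul, hτ])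
  obtain ⟨f, hfA, hfB⟩ := exists_hasValue_one_zero hF hAB
  have h1 : P'.HasValue (∏ σ : H, (σ : F ≃ₐ[K] F) f) 1 := by
    refine HasValue.prod_one fun σ _ => ?_
    have := hfA ((σ⁻¹ : H) • P') (Finset.mem_image_of_mem _ (Finset.mem_univ σ⁻¹))
    simpa using hasValue_smul.1 this
  have h0 : ∏ σ : H, (σ : F ≃ₐ[K] F) f ∈ P.ring.nonunits := by
    have hm : ∀ σ : H, (σ : F ≃ₐ[K] F) f ∈ P.ring.nonunits := by
      intro σ
      have := hfB ((σ⁻¹ : H) • P) (Finset.mem_image_of_mem _ (Finset.mem_univ σ⁻¹))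
      rw [← hasValue_zero_iff]
      simpa using hasValue_smul.1 this
    rw [← Finset.prod_erase_mul _ _ (Finset.mem_univ (1 : H))]
    exact mul_mem_nonunits (prod_mem fun σ _ => P.ring.nonunits_subset (hm σ)) (hm 1)
  have h2 := (h.mem_nonunits ⟨_, prod_mem_fixedField H f⟩).1 h0
  rw [ValuationSubring.mem_nonunits_iff] at h2
  exact h2.ne (h1.valuation_eq_one one_ne_zero)

theorem finrank_fixedField (H : Subgroup (F ≃ₐ[K] F)) :
    Module.finrank (IntermediateField.fixedField H) F =
      Module.finrank (FixedPoints.subfield H F) F :=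
  rfl

theorem LiesOver.sameUnder {L : Type*} [Field L] [Algebra K L] [Algebra L F] {P P' : Place K F}
    {Q : Place K L} (h : P.LiesOver Q) (h' : P'.LiesOver Q) : SameUnder L P P' :=
  fun x => (h x).symm.trans (h' x)

theorem LiesOver.of_sameUnder {L : Type*} [Field L] [Algebra K L] [Algebra L F] {P P' : Place K F}
    {Q : Place K L} (h : P.LiesOver Q) (h' : SameUnder L P P') : P'.LiesOver Q :=
  fun x => (h x).trans (h' x)

/-- A finite group acts freely on the places over a completely split place of its fixed field. -/
theorem IsCompletelySplit.eq_of_smul_eq (hF : IsFunctionField K F) {G : Subgroup (F ≃ₐ[K] F)}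
    [Finite G] {Q : Place K (IntermediateField.fixedField G)} (hQ : Q.IsCompletelySplit F)
    {P : Place K F} (hP : P.LiesOver Q) {σ τ : F ≃ₐ[K] F} (hσ : σ ∈ G) (hτ : τ ∈ G)
    (h : σ • P = τ • P) : σ = τ := by
  let _ := Fintype.ofFinite G
  have himg : (fun σ : F ≃ₐ[K] F => σ • P) '' (G : Set (F ≃ₐ[K] F)) =
      {P' : Place K F | P'.LiesOver Q} := by
    ext P'
    constructor
    · rintro ⟨σ, hσ, rfl⟩
      exact hP.of_sameUnder (sameUnder_smul hσ P)
    · intro hP'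
      exact (hP.sameUnder hP').exists_smul_eq hF
  have hfin : (G : Set (F ≃ₐ[K] F)).Finite := Set.toFinite _
  refine hfin.injOn_of_encard_image_eq (f := fun σ : F ≃ₐ[K] F => σ • P) ?_ hσ hτ h
  rw [himg, hQ.1, finrank_fixedField, FixedPoints.finrank_eq_card G F, ← Set.coe_fintypeCard]
  rfl

/-- The group does not act freely on the places over a totally ramified place, unless it is
trivial: otherwise the norm of a uniformizer at `P` that is a unit at the conjugates of `P` would be
a function on the fixed field with valuation `1` at `P`, and `1` is no multiple of the ramification
index. -/
theorem IsTotallyRamified.exists_smul_eq (hF : IsFunctionField K F) {G : Subgroup (F ≃ₐ[K] F)}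
    [Finite G] (hG : G ≠ ⊥) {P : Place K F}
    (hP : P.IsTotallyRamified (IntermediateField.fixedField G)) :
    ∃ σ ∈ G, σ ≠ 1 ∧ σ • P = P := by
  classical
  by_contra! hne
  let _ := Fintype.ofFinite G
  obtain ⟨Q, hPQ, t, u, ⟨ht0, ht, htm⟩, ⟨hu0, hu, hum⟩, hut, -⟩ := hP
  rw [finrank_fixedField, FixedPoints.finrank_eq_card G F] at hut
  have hcard : 2 ≤ Fintype.card G := by
    have := (Subgroup.one_lt_card_iff_ne_bot G).2 hG
    rwa [Nat.card_eq_fintype_card] at this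
  let T : Finset (Place K F) := (Finset.univ.erase (1 : G)).image fun σ : G => (σ : F ≃ₐ[K] F) • P
  have hT : ∀ σ : G, σ ≠ 1 → (σ : F ≃ₐ[K] F) • P ∈ T := fun σ hσ =>
    Finset.mem_image.2 ⟨σ, by simp [hσ], rfl⟩
  have hPT : P ∉ T := by
    intro h
    obtain ⟨σ, hσ, h⟩ := Finset.mem_image.1 h
    exact hne σ σ.2 (by simpa using hσ) h
  obtain ⟨f, hf, hfT⟩ := exists_hasValue_one_zero hF (A := {P}) (B := T) (by simpa using hPT)
  obtain ⟨g, hgT, hg⟩ := exists_hasValue_one_zero hF (A := T) (B := {P}) (by simpa using hPT)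
  simp only [Finset.mem_singleton, forall_eq] at hf hg
  have hev : ∀ᶠ k : ℕ in Filter.atTop, ∀ P' ∈ T, f ^ k * t ∈ P'.ring.nonunits := by
    refine (Filter.eventually_all_finset T).2 fun P' hP' => ?_
    obtain ⟨k₀, hk⟩ := P'.exists_forall_ge_pow_mul_mem_nonunits hF
      (hasValue_zero_iff.1 (hfT P' hP')) t
    exact Filter.eventually_atTop.2 ⟨k₀, hk⟩
  obtain ⟨k, hk⟩ := hev.exists
  -- `f ^ k * t + g ^ 2` is a uniformizer at `P`, since `g ^ 2` vanishes there to order at least `2`,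
  -- and it has value `1` at the conjugates of `P`
  have hvt0 : 0 < P.ring.valuation t := zero_lt_iff.2 (by simpa using ht0)
  have hxT : ∀ P' ∈ T, P'.HasValue (f ^ k * t + g ^ 2) 1 := by
    intro P' hP'
    simpa using (hasValue_zero_iff.2 (hk P' hP')).add ((hgT P' hP').pow 2)
  have hx : P.ring.valuation (f ^ k * t + g ^ 2) = P.ring.valuation t := by
    have h1 : P.ring.valuation (f ^ k * t) = P.ring.valuation t := by
      rw [map_mul, map_pow, hf.valuation_eq_one one_ne_zero, one_pow, one_mul]
    rw [Valuation.map_add_eq_of_lt_left, h1]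
    have h2 : P.ring.valuation g ≤ P.ring.valuation t := by
      have := (P.ring.valuation_le_one_iff _).2 (htm g (hasValue_zero_iff.1 hg))
      rwa [map_div₀, div_le_one₀ hvt0] at this
    rw [h1, map_pow, pow_two]
    calc _ ≤ P.ring.valuation t * P.ring.valuation g := mul_le_mul_left h2 _
      _ < P.ring.valuation t := mul_lt_of_lt_one_right hvt0 (hasValue_zero_iff.1 hg)
  set x := f ^ k * t + g ^ 2
  have hN : P.ring.valuation (∏ σ : G, (σ : F ≃ₐ[K] F) x) = P.ring.valuation t := by
    rw [← Finset.mul_prod_erase _ _ (Finset.mem_univ (1 : G)), map_mul]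
    have h1 : P.HasValue (∏ σ ∈ Finset.univ.erase (1 : G), (σ : F ≃ₐ[K] F) x) 1 := by
      refine HasValue.prod_one fun σ hσ => ?_
      have := hxT _ (hT σ⁻¹ (by simpa using hσ))
      simpa using hasValue_smul.1 this
    rw [h1.valuation_eq_one one_ne_zero, mul_one]
    simpa using hx
  let N : IntermediateField.fixedField G := ⟨_, prod_mem_fixedField G x⟩
  have hN' : P.ring.valuation (algebraMap _ F N) = P.ring.valuation t := hN
  have hNQ : N ∈ Q.ring.nonunits := by
    rw [ValuationSubring.mem_nonunits_iff_or, hPQ, map_inv₀]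
    have : algebraMap _ F N ∈ P.ring.nonunits := by
      rw [ValuationSubring.mem_nonunits_iff, hN']
      exact ht
    rw [ValuationSubring.mem_nonunits_iff_or] at this
    simpa using this
  have h1 := (hPQ _).1 (hum N hNQ)
  have hu0' : 0 < P.ring.valuation (algebraMap _ F u) := zero_lt_iff.2 (by simpa using hu0)
  rw [← ValuationSubring.valuation_le_one_iff] at h1 hut
  rw [map_div₀, map_div₀, div_le_one₀ hu0', hN'] at h1
  rw [map_div₀, map_pow, div_le_one₀ (pow_pos hvt0 _)] at hut
  have h2 : P.ring.valuation t ^ Fintype.card G ≤ P.ring.valuation t ^ 2 :=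
    pow_le_pow_right_of_le_one' (le_of_lt ht) hcard
  have h3 : P.ring.valuation t ^ 2 < P.ring.valuation t := by
    rw [pow_two]
    exact mul_lt_of_lt_one_right hvt0 ht
  exact absurd (h1.trans (hut.trans h2)) (not_le.2 h3)

end Action

end Place

/-! ### Zeros of functions with a single pole -/

namespace Place

variable {K F : Type*} [Field K] [Field F] [Algebra K F]

theorem exists_mem_nonunits_of_transcendental {y : F} (hy : Transcendental K y) :
    ∃ P : Place K F, y ∈ P.ring.nonunits := by
  let A : Subring F := (Algebra.adjoin K {y}).toSubring
  have hyA : y ∈ A := Algebra.self_mem_adjoin_singleton K y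
  have hy0 : y ≠ 0 := by
    rintro rfl
    exact hy isAlgebraic_zero
  obtain ⟨B, hAB, hB⟩ := Ideal.image_subset_nonunits_valuationSubring
    (Ideal.span {(⟨y, hyA⟩ : A)}) (by
      rw [Ne, Ideal.span_singleton_eq_top]
      intro h
      obtain ⟨⟨c, hc⟩, h1⟩ := isUnit_iff_exists_inv.1 h
      have h2 : y * c = 1 := congrArg Subtype.val h1
      change c ∈ Algebra.adjoin K {y} at hc
      rw [Algebra.adjoin_singleton_eq_range_aeval] at hc
      obtain ⟨p, rfl⟩ := hc
      have h3 : Polynomial.aeval y (Polynomial.X * p - 1) = 0 := by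
        rw [map_sub, map_mul, Polynomial.aeval_X, map_one]
        exact sub_eq_zero.2 h2
      have h4 := congrArg (Polynomial.coeff · 0) (transcendental_iff.1 hy _ h3)
      simp at h4)
  have hyB : y ∈ B.nonunits := hB ⟨⟨y, hyA⟩, Ideal.subset_span rfl, rfl⟩
  refine ⟨⟨B, fun a => hAB (Subalgebra.algebraMap_mem _ a), ?_⟩, hyB⟩
  rintro rfl
  rcases (ValuationSubring.mem_nonunits_iff_or _).1 hyB with h | h
  exacts [hy0 h, h (ValuationSubring.mem_top _)]

/-- A function without poles that has a zero vanishes. -/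
theorem eq_zero_of_forall_mem_ring {x : F} (hx : ∀ P : Place K F, x ∈ P.ring) {P₀ : Place K F}
    (h₀ : x ∈ P₀.ring.nonunits) : x = 0 := by
  by_contra h0
  have htr := P₀.transcendental_of_mem_nonunits h₀ h0
  obtain ⟨P, hP⟩ := exists_mem_nonunits_of_transcendental (K := K) (y := x⁻¹)
    fun h => htr (by simpa using h.inv)
  rcases P.ring.inv_mem_nonunits_iff.1 hP with h | h
  exacts [h0 h, h (hx P)]

/-- The space of the functions that are regular outside `P` and become regular at `P` after
multiplication by `t ^ r`. For a uniformizer `t` at `P` this is `ℒ(r P)`. -/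
def poleSpace (P : Place K F) (t : F) (r : ℕ) : Submodule K F where
  carrier := {x | (∀ P', P' ≠ P → x ∈ P'.ring) ∧ t ^ r * x ∈ P.ring}
  zero_mem' := ⟨fun P' _ => zero_mem _, by simp⟩
  add_mem' := by
    rintro x y ⟨hx, hx'⟩ ⟨hy, hy'⟩
    refine ⟨fun P' h => add_mem (hx P' h) (hy P' h), ?_⟩
    rw [mul_add]
    exact add_mem hx' hy'
  smul_mem' := by
    rintro c x ⟨hx, hx'⟩
    rw [Algebra.smul_def]
    refine ⟨fun P' h => mul_mem (P'.algebraMap_mem c) (hx P' h), ?_⟩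
    rw [mul_left_comm]
    exact mul_mem (P.algebraMap_mem c) hx'

theorem IsUniformizer.mem_poleSpace_of_succ {P : Place K F} {t : F} (ht : P.IsUniformizer t)
    {r : ℕ} {x : F} (hx : x ∈ poleSpace P t (r + 1)) (h : t ^ (r + 1) * x ∈ P.ring.nonunits) :
    x ∈ poleSpace P t r := by
  refine ⟨hx.1, ?_⟩
  have h1 := ht.2.2 _ h
  rwa [pow_succ', mul_assoc, mul_div_cancel_left₀ _ ht.1] at h1

/-- `dim ℒ(r P) ≤ r + 1` for a rational place `P`. -/
theorem IsUniformizer.finrank_poleSpace_le {P : Place K F} (hP : P.IsRational) {t : F}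
    (ht : P.IsUniformizer t) (r : ℕ) :
    FiniteDimensional K (poleSpace P t r) ∧ Module.finrank K (poleSpace P t r) ≤ r + 1 := by
  induction r with
  | zero =>
    have hle : poleSpace P t 0 ≤ Submodule.span K {(1 : F)} := by
      rintro x ⟨hx, hx'⟩
      rw [pow_zero, one_mul] at hx'
      obtain ⟨a, ha⟩ := hP x hx'
      have h0 : x - algebraMap K F a = 0 := by
        refine eq_zero_of_forall_mem_ring (K := K) (fun P' => ?_) ha
        refine sub_mem ?_ (P'.algebraMap_mem a)
        by_cases h : P' = P
        exacts [h ▸ hx', hx P' h]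
      exact Submodule.mem_span_singleton.2
        ⟨a, by rw [← Algebra.algebraMap_eq_smul_one]; exact (sub_eq_zero.1 h0).symm⟩
    exact ⟨Submodule.finiteDimensional_of_le hle,
      (Submodule.finrank_mono hle).trans (finrank_span_singleton (by simp)).le⟩
  | succ r ih =>
    obtain ⟨hfin, hr⟩ := ih
    obtain ⟨x₀, hle⟩ : ∃ x₀ : F, poleSpace P t (r + 1) ≤
        poleSpace P t r ⊔ Submodule.span K {x₀} := by
      by_cases hall : ∀ x ∈ poleSpace P t (r + 1), t ^ (r + 1) * x ∈ P.ring.nonunits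
      · exact ⟨0, fun x hx => Submodule.mem_sup_left (ht.mem_poleSpace_of_succ hx (hall x hx))⟩
      push Not at hall
      obtain ⟨x₀, hx₀, hn⟩ := hall
      obtain ⟨b, hb⟩ := hP _ hx₀.2
      have hb0 : b ≠ 0 := by
        rintro rfl
        exact hn (hasValue_zero_iff.1 hb)
      refine ⟨x₀, fun x hx => ?_⟩
      obtain ⟨a, ha⟩ := hP _ hx.2
      have h1 : x - (a / b) • x₀ ∈ poleSpace P t r := by
        refine ht.mem_poleSpace_of_succ (sub_mem hx (Submodule.smul_mem _ _ hx₀)) ?_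
        have := ha.add (hb.smul (-(a / b)))
        rw [neg_mul, div_mul_cancel₀ _ hb0, add_neg_cancel, hasValue_zero_iff] at this
        rwa [mul_sub, mul_smul_comm, sub_eq_add_neg, ← neg_smul]
      rw [← sub_add_cancel x ((a / b) • x₀)]
      exact Submodule.add_mem_sup h1 (Submodule.smul_mem _ _ (Submodule.mem_span_singleton_self x₀))
    refine ⟨Submodule.finiteDimensional_of_le hle, (Submodule.finrank_mono hle).trans ?_⟩
    refine (Submodule.finrank_add_le_finrank_add_finrank _ _).trans ?_
    exact add_le_add hr ((finrank_span_le_card _).trans (by simp))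

theorem HasValue.aeval {P : Place K F} {f : F} {a : K} (h : P.HasValue f a) (p : Polynomial K) :
    P.HasValue (Polynomial.aeval f p) (p.eval a) := by
  rw [Polynomial.aeval_eq_sum_range, Polynomial.eval_eq_sum_range]
  exact HasValue.sum fun i _ => (h.pow i).smul _

/-- Functions that take the values `0` and `1` at the zeros of `f` like the unit vectors are
linearly independent over `K[f]`. -/
theorem eq_zero_of_sum_aeval_mul_eq_zero {T : Finset (Place K F)} {f : F} (hf0 : f ≠ 0)
    (hf : ∀ P ∈ T, P.HasValue f 0) {e : T → F} (he1 : ∀ P : T, P.1.HasValue (e P) 1)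
    (he0 : ∀ P P' : T, P' ≠ P → P'.1.HasValue (e P) 0) (q : T → Polynomial K)
    (h : ∑ P, Polynomial.aeval f (q P) * e P = 0) : q = 0 := by
  classical
  have hstep : ∀ q : T → Polynomial K, ∑ P, Polynomial.aeval f (q P) * e P = 0 →
      ∀ P, Polynomial.X ∣ q P := by
    intro q h P
    rw [Polynomial.X_dvd_iff, Polynomial.coeff_zero_eq_eval_zero]
    have h1 : P.1.HasValue (∑ P', Polynomial.aeval f (q P') * e P')
        (∑ P', (q P').eval 0 * if P' = P then 1 else 0) := by
      refine HasValue.sum fun P' _ => ((hf P P.2).aeval (q P')).mul ?_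
      split_ifs with hPP
      · exact hPP ▸ he1 P'
      · exact he0 P' P (Ne.symm hPP)
    rw [h] at h1
    simpa using h1.unique (hasValue_zero_iff.2 (zero_mem _))
  -- dividing by `f` and repeating the step shows that every power of `X` divides all `q P`
  have hdvd : ∀ N : ℕ, ∃ q' : T → Polynomial K, (∀ P, q P = Polynomial.X ^ N * q' P) ∧
      ∑ P, Polynomial.aeval f (q' P) * e P = 0 := by
    intro N
    induction N with
    | zero => exact ⟨q, by simp, h⟩
    | succ N ih =>
      obtain ⟨q', hq', hs⟩ := ih
      choose q'' hq'' using hstep q' hs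
      refine ⟨q'', fun P => by rw [hq', hq'', pow_succ, mul_assoc], ?_⟩
      have h2 : f * ∑ P, Polynomial.aeval f (q'' P) * e P = 0 := by
        rw [← hs, Finset.mul_sum]
        refine Finset.sum_congr rfl fun P _ => ?_
        rw [hq'', map_mul, Polynomial.aeval_X, mul_assoc]
      exact (mul_eq_zero.1 h2).resolve_left hf0
  funext P
  by_contra hP
  obtain ⟨q', hq', -⟩ := hdvd ((q P).natDegree + 1)
  have := Polynomial.natDegree_le_of_dvd (Dvd.intro _ (hq' P).symm) hP
  rw [Polynomial.natDegree_X_pow] at this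
  omega

/-- A nonzero function in `ℒ(m P)`, for a rational place `P`, has at most `m` zeros. With
`e₁, …, e_N ∈ F` independent over `K[f]` and integral over it, the functions
`f ^ i * e_j`, `i ≤ k`, are `(k + 1) N` independent elements of `ℒ((m k + c) P)`, where `c` does
not depend on `k`. -/
theorem card_zeros_le (hF : IsFunctionField K F) {Pinf : Place K F} (hrat : Pinf.IsRational)
    {t : F} (ht : Pinf.IsUniformizer t) {m : ℕ} {f : F} (hf0 : f ≠ 0)
    (hfm : f ∈ poleSpace Pinf t m) {T : Finset (Place K F)} (hf : ∀ P ∈ T, P.HasValue f 0) :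
    T.card ≤ m := by
  classical
  rcases T.eq_empty_or_nonempty with rfl | ⟨P₁, hP₁⟩
  · simp
  have htr : Transcendental K f :=
    P₁.transcendental_of_mem_nonunits (hasValue_zero_iff.1 (hf P₁ hP₁)) hf0
  have halg := hF.isAlgebraic_adjoin htr
  have he : ∀ P : T, ∃ e : F, P.1.HasValue e 1 ∧ ∀ P' : T, P' ≠ P → P'.1.HasValue e 0 := by
    intro P
    obtain ⟨e, he1, he0⟩ := exists_hasValue_one_zero hF (A := {P.1}) (B := T.erase P.1) (by simp)
    exact ⟨e, he1 _ (by simp), fun P' h => he0 _ (by simp [h])⟩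
  choose e he1 he0 using he
  have hD : ∀ P : T, ∃ D : Polynomial K, D ≠ 0 ∧
      IsIntegral (Algebra.adjoin K {f}) (Polynomial.aeval f D * e P) := by
    intro P
    obtain ⟨⟨c, hc⟩, hc0, hint⟩ := (Algebra.IsAlgebraic.isAlgebraic
      (R := Algebra.adjoin K {f}) (e P)).exists_integral_multiple
    have hc' := hc
    rw [Algebra.adjoin_singleton_eq_range_aeval] at hc'
    obtain ⟨D, rfl⟩ := hc'
    refine ⟨D, ?_, hint⟩
    rintro rfl
    exact hc0 (by ext; simp)
  choose D hD0 hDint using hD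
  have hreg : ∀ (P : T) (P' : Place K F), P' ≠ Pinf → Polynomial.aeval f (D P) * e P ∈ P'.ring :=
    fun P P' hP' => P'.mem_of_isIntegral_adjoin (hfm.1 P' hP') (hDint P)
  have htO := Pinf.ring.nonunits_subset ht.2.1
  have hc : ∀ᶠ c : ℕ in Filter.atTop, ∀ P ∈ (Finset.univ : Finset T),
      t ^ c * (Polynomial.aeval f (D P) * e P) ∈ Pinf.ring.nonunits := by
    refine (Filter.eventually_all_finset _).2 fun P _ => ?_
    obtain ⟨k₀, hk⟩ := Pinf.exists_forall_ge_pow_mul_mem_nonunits hF ht.2.1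
      (Polynomial.aeval f (D P) * e P)
    exact Filter.eventually_atTop.2 ⟨k₀, hk⟩
  obtain ⟨c, hc⟩ := hc.exists
  by_contra! hlt
  -- `(m + 1) (k + 1) > m k + c + 1` as soon as `k + m > c`
  let k := c + 1
  let Φ : (T → Polynomial.degreeLT K (k + 1)) →ₗ[K] F :=
    { toFun := fun p => ∑ P, Polynomial.aeval f (p P : Polynomial K) *
        (Polynomial.aeval f (D P) * e P)
      map_add' := fun p q => by simp [add_mul, Finset.sum_add_distrib]
      map_smul' := fun a p => by simp [Finset.smul_sum] }
  have hΦ : ∀ p, Φ p ∈ poleSpace Pinf t (m * k + c) := by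
    intro p
    refine Submodule.sum_mem _ fun P _ => ?_
    have hdeg : (p P : Polynomial K).natDegree < k + 1 := by
      by_cases h : (p P : Polynomial K) = 0
      · simp [h]
      · exact (Polynomial.natDegree_lt_iff_degree_lt h).2 (Polynomial.mem_degreeLT.1 (p P).2)
    rw [Polynomial.aeval_eq_sum_range' hdeg, Finset.sum_mul]
    refine Submodule.sum_mem _ fun i hi => ?_
    rw [smul_mul_assoc]
    refine Submodule.smul_mem _ _ ⟨fun P' hP' => mul_mem (pow_mem (hfm.1 P' hP') i)
      (hreg P P' hP'), ?_⟩
    obtain ⟨j, hj⟩ := Nat.exists_eq_add_of_le (Nat.lt_succ_iff.1 (Finset.mem_range.1 hi))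
    have e1 : t ^ (m * k + c) * (f ^ i * (Polynomial.aeval f (D P) * e P)) =
        (t ^ m * f) ^ i * t ^ (m * j) * (t ^ c * (Polynomial.aeval f (D P) * e P)) := by
      rw [hj]
      ring
    rw [e1]
    exact mul_mem (mul_mem (pow_mem hfm.2 i) (pow_mem htO _))
      (Pinf.ring.nonunits_subset (hc P (Finset.mem_univ P)))
  -- a relation `∑ p_P(f) D_P(f) e_P = 0` forces `p_P D_P = 0`, and `D_P ≠ 0`
  have hinj : Function.Injective (Φ.codRestrict _ hΦ) := by
    rw [← LinearMap.ker_eq_bot, LinearMap.ker_codRestrict, LinearMap.ker_eq_bot']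
    intro p hp
    have h0 := eq_zero_of_sum_aeval_mul_eq_zero hf0 hf he1 he0 (fun P => (p P) * D P) (by
      simpa [Φ, mul_assoc] using hp)
    funext P
    exact Subtype.ext ((mul_eq_zero.1 (congrFun h0 P)).resolve_right (hD0 P))
  obtain ⟨hfin, hdim⟩ := ht.finrank_poleSpace_le hrat (m * k + c)
  have h1 := (LinearMap.finrank_le_finrank_of_injective hinj).trans hdim
  have h2 : Module.finrank K (T → Polynomial.degreeLT K (k + 1)) = T.card * (k + 1) := by
    rw [Module.finrank_pi_fintype]
    simp [(Polynomial.degreeLTEquiv K (k + 1)).finrank_eq]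
  rw [h2] at h1
  have h3 : (m + 1) * (k + 1) ≤ T.card * (k + 1) := Nat.mul_le_mul_right _ hlt
  have h4 : (m + 1) * (k + 1) = m * k + m + k + 1 := by ring
  simp only [k] at *
  omega

theorem mem_poleSpace_of_mem_riemannRoch {P : Place K F} {m : ℕ} {f : F}
    (hf : f ∈ riemannRoch (Finsupp.single P (m : ℤ))) :
    ∃ t, P.IsUniformizer t ∧ f ∈ poleSpace P t m := by
  obtain ⟨t, ht, h⟩ := hf P
  refine ⟨t, ht, fun P' hP' => ?_, ?_⟩
  · obtain ⟨t', -, h'⟩ := hf P'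
    simpa [Finsupp.single_apply, hP'.symm] using h'
  · simpa [div_inv_eq_mul, mul_comm] using h

end Place

/-! ### Products and unions of subgroups -/

theorem List.subset_prod_ofFn {α : Type*} [Monoid α] {s : ℕ} (A : Fin s → Set α)
    (h1 : ∀ i, (1 : α) ∈ A i) (i : Fin s) : A i ⊆ (List.ofFn A).prod := by
  induction s with
  | zero => exact i.elim0
  | succ s ih =>
    have hone : ∀ {s : ℕ} (A : Fin s → Set α), (∀ i, (1 : α) ∈ A i) →
        (1 : α) ∈ (List.ofFn A).prod := by
      intro s
      induction s with
      | zero => intro A _; simp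
      | succ s ih =>
        intro A h
        rw [List.ofFn_succ, List.prod_cons]
        exact Set.mem_mul.2 ⟨1, h 0, 1, ih _ fun i => h _, one_mul 1⟩
    rw [List.ofFn_succ, List.prod_cons]
    refine Fin.cases ?_ (fun j => ?_) i
    · exact Set.subset_mul_left _ (hone _ fun i => h1 _)
    · exact (ih _ (fun i => h1 _) j).trans (Set.subset_mul_right _ (h1 0))

theorem List.finite_prod_ofFn {α : Type*} [Monoid α] {s : ℕ} (A : Fin s → Set α)
    (h : ∀ i, (A i).Finite) : (List.ofFn A).prod.Finite := by
  induction s with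
  | zero => simp
  | succ s ih =>
    rw [List.ofFn_succ, List.prod_cons]
    exact (h 0).mul (ih _ fun i => h _)

section Counting

variable {A : Type*} [Group A] {s : ℕ}

/-- The elements of `H i` other than `1` that lie in none of the subgroups `H j`, `j < i`. -/
def newElements (H : Fin s → Subgroup A) (i : Fin s) : Set A :=
  (H i : Set A) \ ({1} ∪ ⋃ j : Fin s, ⋃ _ : j < i, (H j : Set A))

theorem finite_of_finite_newElements {H : Fin s → Subgroup A}
    (h : ∀ i, (newElements H i).Finite) (i : Fin s) : (H i : Set A).Finite := by
  induction i using WellFoundedLT.induction with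
  | ind i ih =>
    refine Set.Finite.of_sdiff (h i) ((Set.finite_singleton 1).union ?_)
    exact Set.finite_iUnion fun j => Set.finite_iUnion fun hj => ih j hj

end Counting

/-! ### Codes, interpolation and repair sets -/

/-- Evaluation at a rational place is linear. -/
theorem Place.IsRational.exists_linearMap {K F : Type*} [Field K] [Field F] [Algebra K F]
    {P : Place K F} (hP : P.IsRational) (V : Submodule K F) (hV : ∀ f ∈ V, f ∈ P.ring) :
    ∃ φ : V →ₗ[K] K, ∀ f : V, P.HasValue f (φ f) := by
  choose φ hφ using fun f : V => hP f (hV f f.2)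
  exact ⟨{ toFun := φ
           map_add' := fun f g => (hφ (f + g)).unique ((hφ f).add (hφ g))
           map_smul' := fun c f => (hφ (c • f)).unique ((hφ f).smul c) }, hφ⟩

section Code

variable {K : Type*} [Field K] {k n : ℕ}

/-- A linear relation between the coordinates of all codewords is one between the columns of
a generator matrix. -/
theorem IsGeneratorMatrix.col_mem_span {M : Matrix (Fin k) (Fin n) K}
    {C : Submodule K (Fin n → K)} (hM : IsGeneratorMatrix M C) {a : Fin n} {R : Finset (Fin n)}
    (c : Fin n → K) (h : ∀ x ∈ C, x a = ∑ b ∈ R, c b * x b) :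
    M.col a ∈ Submodule.span K (M.col '' R) := by
  have e : M.col a = ∑ b ∈ R, c b • M.col b := by
    funext i
    have hi : M.row i ∈ C := hM.2 ▸ Submodule.subset_span ⟨i, rfl⟩
    simpa using h _ hi
  rw [e]
  exact Submodule.sum_mem _ fun b hb => Submodule.smul_mem _ _ (Submodule.subset_span ⟨b, hb, rfl⟩)

theorem exists_isGeneratorMatrix (C : Submodule K (Fin n → K)) (h : Module.finrank K C = k) :
    ∃ M : Matrix (Fin k) (Fin n) K, IsGeneratorMatrix M C := by
  subst h
  let b := Module.finBasis K C
  refine ⟨Matrix.of fun i => (b i : Fin n → K), ?_, ?_⟩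
  · exact b.linearIndependent.map' C.subtype (Submodule.ker_subtype C)
  · have h1 := congrArg (Submodule.map C.subtype) b.span_eq
    rw [Submodule.map_span, ← Set.range_comp, Submodule.map_subtype_top] at h1
    exact h1

/-- Lagrange interpolation: the value at `x a` of a polynomial of degree `< #R` is a fixed linear
combination of its values at the points `x b`, `b ∈ R`. -/
theorem Polynomial.eval_eq_sum_lagrange {ι : Type*} [DecidableEq ι] {R : Finset ι} {x : ι → K}
    (hx : Set.InjOn x R) {p : Polynomial K} (hp : p.degree < R.card) (y : K) :
    p.eval y = ∑ b ∈ R, (Lagrange.basis R x b).eval y * p.eval (x b) := by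
  conv_lhs => rw [Lagrange.eq_interpolate hx hp, Lagrange.interpolate_apply]
  rw [Polynomial.eval_finsetSum]
  exact Finset.sum_congr rfl fun b _ => by rw [Polynomial.eval_mul, Polynomial.eval_C, mul_comm]

end Code

section FibreRepairSets

open Place

variable {K F : Type*} [Field K] [Field F] [Algebra K F]

theorem exists_polynomial_of_mem_functionSpace {r t : ℕ} {z w f : F}
    (hf : f ∈ functionSpace K r t z w) (ζ : K) :
    ∃ p : Polynomial K, p.degree < r ∧ ∀ (P : Place K F) (ω : K), P.HasValue z ζ → P.HasValue w ω →
      P.HasValue f (p.eval ω) := by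
  obtain ⟨c, rfl⟩ := hf
  refine ⟨∑ l ∈ Finset.range r, Polynomial.C (∑ j ∈ Finset.range (t + 1), c l j * ζ ^ j) *
    Polynomial.X ^ l, ?_, fun P ω hz hw => ?_⟩
  · refine Polynomial.mem_degreeLT.1 (Submodule.sum_mem _ fun l hl => ?_)
    exact Polynomial.mem_degreeLT.2 ((Polynomial.degree_C_mul_X_pow_le _ _).trans_lt
      (by exact_mod_cast Finset.mem_range.1 hl))
  · rw [Polynomial.eval_finsetSum]
    refine HasValue.sum fun l _ => ?_
    rw [Polynomial.eval_mul, Polynomial.eval_C, Polynomial.eval_pow, Polynomial.eval_X]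
    exact (HasValue.sum fun j _ => (hz.pow j).smul _).mul (hw.pow l)

/-- The fibre of `P` over the fixed field of a group acting freely on it, without `P` and without
the fibres over the preceding fixed fields, is parametrized by the new elements of the group. -/
theorem ncard_fibreRepairSet (hF : IsFunctionField K F) {s n : ℕ}
    {H : Fin s → Subgroup (F ≃ₐ[K] F)} [∀ i, Finite (H i)] {G : Subgroup (F ≃ₐ[K] F)}
    (hHG : ∀ i, H i ≤ G) {P : Fin n → Place K F} (hP : Function.Injective P)
    (hGP : ∀ a, ∀ σ ∈ G, ∃ b, P b = σ • P a)
    (hfree : ∀ a, ∀ σ ∈ G, ∀ τ ∈ G, σ • P a = τ • P a → σ = τ) (a : Fin n) (i : Fin s) :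
    (fibreRepairSet H P a i).ncard = (newElements H i).ncard := by
  have himg : P '' fibreRepairSet H P a i = (fun σ => σ • P a) '' newElements H i := by
    ext Q
    constructor
    · rintro ⟨b, ⟨hba, hi, hj⟩, rfl⟩
      obtain ⟨σ, hσ, h⟩ := hi.exists_smul_eq hF
      refine ⟨σ, ⟨hσ, ?_⟩, h⟩
      rintro (h1 | h1)
      · rw [Set.mem_singleton_iff.1 h1, one_smul] at h
        exact hba (hP h).symm
      · obtain ⟨j, hji, hσj⟩ := Set.mem_iUnion₂.1 h1
        exact hj j hji (h ▸ sameUnder_smul hσj (P a))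
    · rintro ⟨σ, ⟨hσ, hn⟩, rfl⟩
      obtain ⟨b, hb⟩ := hGP a σ (hHG i hσ)
      refine ⟨b, ⟨?_, hb ▸ sameUnder_smul hσ (P a), fun j hj hs => ?_⟩, hb⟩
      · rintro rfl
        refine hn (Or.inl (hfree b σ (hHG i hσ) 1 (one_mem G) ?_))
        rw [one_smul, ← hb]
      · obtain ⟨τ, hτ, h⟩ := hs.exists_smul_eq hF
        refine hn (Or.inr (Set.mem_iUnion₂.2 ⟨j, hj, ?_⟩))
        rwa [hfree a σ (hHG i hσ) τ (hHG j hτ) (hb.symm.trans h.symm)]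
  rw [← Set.ncard_image_of_injective _ hP, himg]
  refine Set.InjOn.ncard_image fun σ hσ τ hτ h => ?_
  exact hfree a σ (hHG i hσ.1) τ (hHG i hτ.1) h

theorem disjoint_fibreRepairSet {s n : ℕ} (H : Fin s → Subgroup (F ≃ₐ[K] F))
    (P : Fin n → Place K F) (a : Fin n) {i j : Fin s} (hij : i ≠ j) :
    Disjoint (fibreRepairSet H P a i) (fibreRepairSet H P a j) := by
  rw [Set.disjoint_left]
  rintro b ⟨-, hi, hi'⟩ ⟨-, hj, hj'⟩
  rcases lt_or_gt_of_ne hij with h | h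
  exacts [hj' i h hi, hi' j h hj]

/-- If `z ∈ L` has its only pole at the place of `L` under `Pinf`, then `z` is regular at every
place of `F` that lies over another place of `L`. -/
theorem mem_ring_of_poles_eq {L : Type*} [Field L] [Algebra K L] [Algebra L F]
    [IsScalarTower K L F] {Pinf P : Place K F} {Q : Place K L} (hQ : Pinf.LiesOver Q) {z : L}
    (hz : poles K z = {Q}) (hP : ¬ SameUnder L Pinf P) : algebraMap L F z ∈ P.ring := by
  by_contra h
  let Q' : Place K L :=
    { ring := P.ring.comap (algebraMap L F)
      algebraMap_mem := fun a => by
        rw [ValuationSubring.mem_comap, ← IsScalarTower.algebraMap_apply]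
        exact P.algebraMap_mem a
      ne_top := fun h' => h (ValuationSubring.mem_comap.1 (h' ▸ ValuationSubring.mem_top z)) }
  have hQ' : Q' ∈ poles K z := h
  rw [hz, Set.mem_singleton_iff] at hQ'
  exact hP (hQ.sameUnder (hQ' ▸ fun x => Iff.rfl))

/-- A column of a generator matrix is a combination of the columns in its repair set: on the fibre
of `P a` the function `z` is constant, so each `f ∈ V` is a polynomial of degree less than the size
of the repair set in the values of `w`, and these values are distinct. -/
theorem col_mem_span_of_functionSpace (hF : IsFunctionField K F) {s n : ℕ}
    {H : Fin s → Subgroup (F ≃ₐ[K] F)} {P : Fin n → Place K F}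
    (hrat : ∀ a, (P a).IsRational) (hP : Function.Injective P) {i : Fin s} [Finite (H i)]
    {z : IntermediateField.fixedField (H i)} {w : F}
    (hz : ∀ a, (z : F) ∈ (P a).ring) (hw : ∀ a, w ∈ (P a).ring)
    (hwinj : ∀ a, ∀ P' ∈ orbit (H i) (P a), ∀ P'' ∈ orbit (H i) (P a),
      ∀ c : K, P'.HasValue w c → P''.HasValue w c → P' = P'')
    {t k : ℕ} {V : Submodule K F} {a : Fin n}
    (hV : V ≤ functionSpace K (fibreRepairSet H P a i).ncard t (z : F) w)
    {M : Matrix (Fin k) (Fin n) K} (hM : IsGeneratorMatrix M (evalCode P V)) :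
    M.col a ∈ Submodule.span K (M.col '' fibreRepairSet H P a i) := by
  classical
  have hfin : (fibreRepairSet H P a i).Finite := Set.toFinite _
  obtain ⟨R, hR⟩ : ∃ R : Finset (Fin n), (R : Set (Fin n)) = fibreRepairSet H P a i :=
    ⟨hfin.toFinset, hfin.coe_toFinset⟩
  rw [← hR] at hV ⊢
  rw [Set.ncard_coe_finset] at hV
  choose ω hω using fun b => hrat b w (hw b)
  obtain ⟨ζ, hζ⟩ := hrat a z (hz a)
  have hR' : ∀ b ∈ R, SameUnder (IntermediateField.fixedField (H i)) (P a) (P b) := by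
    intro b hb
    have : b ∈ fibreRepairSet H P a i := hR ▸ hb
    exact this.2.1
  have hωinj : Set.InjOn ω R := by
    intro b hb b' hb' h
    refine hP (hwinj a _ ?_ _ ?_ (ω b) (hω b) (h ▸ hω b'))
    · exact mem_orbit_iff.2 ((hR' b hb).exists_smul_eq hF)
    · exact mem_orbit_iff.2 ((hR' b' hb').exists_smul_eq hF)
  have hζR : ∀ b ∈ R, (P b).HasValue z ζ := fun b hb =>
    ((hR' b hb).mem_nonunits (z - algebraMap K _ ζ)).1 hζ
  refine hM.col_mem_span (fun b => (Lagrange.basis R ω b).eval (ω a)) fun x hx => ?_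
  obtain ⟨f, hf, hfx⟩ := hx
  obtain ⟨p, hp, hpf⟩ := exists_polynomial_of_mem_functionSpace (hV hf) ζ
  rw [(hfx a).unique (hpf _ _ hζ (hω a)), Polynomial.eval_eq_sum_lagrange hωinj hp]
  exact Finset.sum_congr rfl fun b hb => by
    rw [(hfx b).unique (hpf _ _ (hζR b hb) (hω b))]

theorem card_zeros_le_of_mem_riemannRoch (hF : IsFunctionField K F) {n d : ℕ} (hdn : d ≤ n)
    {P : Fin n → Place K F} (hP : Function.Injective P) {Pinf : Place K F}
    (hrat : Pinf.IsRational) {f : F} (hf0 : f ≠ 0)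
    (hf : f ∈ riemannRoch (Finsupp.single Pinf ((n : ℤ) - (d : ℤ)))) :
    {a | (P a).HasValue f 0}.ncard ≤ n - d := by
  classical
  rw [← Nat.cast_sub hdn] at hf
  obtain ⟨t, ht, hft⟩ := mem_poleSpace_of_mem_riemannRoch hf
  have hfin : {a | (P a).HasValue f 0}.Finite := Set.toFinite _
  have := card_zeros_le hF hrat ht hf0 hft (T := hfin.toFinset.image P) (by simp)
  rwa [Finset.card_image_of_injective _ hP, ← Set.ncard_eq_toFinset_card _ hfin] at this

end FibreRepairSets

theorem theorem5p1 {K F : Type*} [Field K] [Finite K] [Field F] [Algebra K F]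
    (hF : IsFunctionField K F)
    {s : ℕ} (hs : 1 ≤ s) (H : Fin s → Subgroup (F ≃ₐ[K] F)) (hH : ∀ i, H i ≠ ⊥)
    -- the product set `H₁ ⋯ H_s` is a group `G`
    (G : Subgroup (F ≃ₐ[K] F))
    (hG : (G : Set (F ≃ₐ[K] F)) = (List.ofFn fun i => (H i : Set (F ≃ₐ[K] F))).prod)
    (r : Fin s → ℕ)
    (hr : ∀ i, ((H i : Set (F ≃ₐ[K] F)) \
      ({1} ∪ ⋃ j : Fin s, ⋃ _ : j < i, (H j : Set (F ≃ₐ[K] F)))).encard = r i)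
    -- `P₁, …, Pₙ` are the places over a set `S` of rational places of `F^G`, completely split
    (S : Set (Place K (IntermediateField.fixedField G)))
    (hS : ∀ Q ∈ S, Q.IsRational ∧ Q.IsCompletelySplit F)
    {n : ℕ} (P : Fin n → Place K F) (hP : Function.Injective P)
    (hPS : Set.range P = {P' : Place K F | ∃ Q ∈ S, P'.LiesOver Q})
    -- the totally ramified rational place and the places below it
    (Pinf : Place K F) (hrat : Pinf.IsRational)
    (hram : Pinf.IsTotallyRamified (IntermediateField.fixedField G))
    (Qinf : ∀ i, Place K (IntermediateField.fixedField (H i)))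
    (hQinf : ∀ i, Pinf.LiesOver (Qinf i))
    (z : ∀ i, IntermediateField.fixedField (H i)) (hz : ∀ i, Place.poles K (z i) = {Qinf i})
    (w : Fin s → F) (hw : ∀ i, w i ∉ IntermediateField.fixedField (H i))
    (hwpoles : ∀ i, Place.poles K (w i) = {Pinf})
    -- `w_i` is injective on the orbit of each `P_a` under `H_i`
    (hwinj : ∀ i a, ∀ P' ∈ Place.orbit (H i) (P a), ∀ P'' ∈ Place.orbit (H i) (P a),
      ∀ c : K, P'.HasValue (w i) c → P''.HasValue (w i) c → P' = P'')
    (t : Fin s → ℕ) (ht : ∀ i, 1 ≤ t i)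
    (d : ℕ) (hd : 1 ≤ d) (hdn : d ≤ n)
    (hV : ∀ i, (functionSpace K (r i) (t i) (z i : F) (w i) : Set F) ⊆
      Place.riemannRoch (Finsupp.single Pinf ((n : ℤ) - (d : ℤ))))
    (V : Submodule K F) (hVdef : V = ⨅ i, functionSpace K (r i) (t i) (z i : F) (w i))
    (hVpos : 0 < Module.finrank K V) :
    IsRecoverableCode (evalCode P V) (Module.finrank K V) d r ∧
      ∀ (M : Matrix (Fin (Module.finrank K V)) (Fin n) K), IsGeneratorMatrix M (evalCode P V) →
        ∀ a, IsRepairFamily M r a (fibreRepairSet H P a) := by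
  have hHfin : ∀ i, Finite (H i) := fun i =>
    (finite_of_finite_newElements (fun j => Set.finite_of_encard_eq_coe (hr j)) i).to_subtype
  have hHG : ∀ i, H i ≤ G := by
    intro i σ hσ
    rw [← SetLike.mem_coe, hG]
    exact List.subset_prod_ofFn (fun i => (H i : Set (F ≃ₐ[K] F))) (fun i => one_mem (H i)) i hσ
  have hGfin : Finite G := by
    have := List.finite_prod_ofFn (fun i => (H i : Set (F ≃ₐ[K] F))) fun i => Set.toFinite _
    rw [← hG] at this
    exact this.to_subtype
  have i₀ : Fin s := ⟨0, hs⟩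
  have hGbot : G ≠ ⊥ := fun h => hH i₀ (le_bot_iff.1 (h ▸ hHG i₀))
  have hPQ : ∀ a, ∃ Q ∈ S, (P a).LiesOver Q := fun a => hPS.subset ⟨a, rfl⟩
  have hfree : ∀ a, ∀ σ ∈ G, ∀ τ ∈ G, σ • P a = τ • P a → σ = τ := by
    intro a σ hσ τ hτ h
    obtain ⟨Q, hQ, hPQ⟩ := hPQ a
    exact (hS Q hQ).2.eq_of_smul_eq hF hPQ hσ hτ h
  have hGP : ∀ a, ∀ σ ∈ G, ∃ b, P b = σ • P a := by
    intro a σ hσ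
    obtain ⟨Q, hQ, hPQ⟩ := hPQ a
    exact hPS.superset ⟨Q, hQ, hPQ.of_sameUnder (Place.sameUnder_smul hσ _)⟩
  have hPrat : ∀ a, (P a).IsRational := by
    intro a
    obtain ⟨Q, hQ, hPQ⟩ := hPQ a
    exact (hS Q hQ).2.2 _ hPQ
  -- no `P a` is a conjugate of `Pinf`, for the action is free at the former and not at the latter
  have hPinf : ∀ a, ∀ σ ∈ G, σ • Pinf ≠ P a := by
    intro a σ hσ h
    obtain ⟨τ, hτ, hτ1, hτP⟩ := hram.exists_smul_eq hF hGbot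
    obtain ⟨b, hb⟩ := hGP a σ⁻¹ (inv_mem hσ)
    rw [← h, inv_smul_smul] at hb
    exact hτ1 (hfree b τ hτ 1 (one_mem G) (by rw [hb, hτP, one_smul]))
  have hPinf1 : ∀ a, P a ≠ Pinf := fun a h => hPinf a 1 (one_mem G) (by rw [one_smul, h])
  have hVle : ∀ i, V ≤ functionSpace K (r i) (t i) (z i : F) (w i) := fun i => hVdef ▸ iInf_le _ i
  have hVRR : ∀ f ∈ V, f ∈ Place.riemannRoch (Finsupp.single Pinf ((n : ℤ) - (d : ℤ))) :=
    fun f hf => hV i₀ (hVle i₀ hf)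
  have hVreg : ∀ a, ∀ f ∈ V, f ∈ (P a).ring := by
    intro a f hf
    have := hVRR f hf
    rw [← Nat.cast_sub hdn] at this
    obtain ⟨_, -, h⟩ := Place.mem_poleSpace_of_mem_riemannRoch this
    exact h.1 _ (hPinf1 a)
  have hzreg : ∀ i a, (z i : F) ∈ (P a).ring := by
    intro i a
    refine mem_ring_of_poles_eq (hQinf i) (hz i) fun h => ?_
    obtain ⟨σ, hσ, hσP⟩ := h.exists_smul_eq hF
    exact hPinf a σ (hHG i hσ) hσP
  have hwreg : ∀ i a, w i ∈ (P a).ring := by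
    intro i a
    by_contra h
    have : P a ∈ Place.poles K (w i) := h
    rw [hwpoles i] at this
    exact hPinf1 a this
  have hrepair : ∀ (M : Matrix (Fin (Module.finrank K V)) (Fin n) K),
      IsGeneratorMatrix M (evalCode P V) →
        ∀ a, IsRepairFamily M r a (fibreRepairSet H P a) := by
    intro M hM a
    refine ⟨fun i j hij => disjoint_fibreRepairSet H P a hij, fun i => ⟨fun h => h.1 rfl, ?_⟩⟩
    have hcard : (fibreRepairSet H P a i).ncard = r i := by
      rw [ncard_fibreRepairSet hF hHG hP hGP hfree a i, newElements, Set.ncard, hr i]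
      rfl
    refine ⟨hcard, ?_⟩
    refine col_mem_span_of_functionSpace hF hPrat hP (hzreg i) (hwreg i) (hwinj i) (t := t i) ?_ hM
    rw [hcard]
    exact hVle i
  choose φ hφ using fun a => (hPrat a).exists_linearMap V (hVreg a)
  have hzeros : ∀ f ∈ V, f ≠ 0 → {a | (P a).HasValue f 0}.ncard ≤ n - d := fun f hf hf0 =>
    card_zeros_le_of_mem_riemannRoch hF hdn hP hrat hf0 (hVRR f hf)
  have hinj : Function.Injective (LinearMap.pi φ) := by
    rw [← LinearMap.ker_eq_bot, LinearMap.ker_eq_bot']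
    intro f hf
    by_contra hf0
    have h1 := hzeros f f.2 (by simpa using hf0)
    have h2 : {a | (P a).HasValue (f : F) 0} = Set.univ := by
      refine Set.eq_univ_of_forall fun a => ?_
      have h3 := hφ a f
      rwa [show φ a f = 0 from congrFun hf a] at h3
    rw [h2, Set.ncard_univ, Nat.card_fin] at h1
    omega
  have hrange : LinearMap.range (LinearMap.pi φ) = evalCode P V := by
    ext x
    constructor
    · rintro ⟨f, rfl⟩
      exact ⟨f, f.2, fun a => hφ a f⟩
    · rintro ⟨f, hf, hx⟩
      exact ⟨⟨f, hf⟩, funext fun a => (hφ a ⟨f, hf⟩).unique (hx a)⟩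
  have hdim : Module.finrank K (evalCode P V) = Module.finrank K V := by
    rw [← hrange, LinearMap.finrank_range_of_inj hinj]
  refine ⟨⟨?_, ?_⟩, hrepair⟩
  · intro c hc c' hc' hne
    obtain ⟨f, hf, hfc⟩ := (evalCode P V).sub_mem hc hc'
    have hf0 : f ≠ 0 := by
      rintro rfl
      refine hne (funext fun a => sub_eq_zero.1 ?_)
      exact (hfc a).unique (Place.hasValue_zero_iff.2 (zero_mem _))
    have h1 := hzeros f hf hf0
    have h2 : {a | c a ≠ c' a}ᶜ ⊆ {a | (P a).HasValue f 0} := by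
      intro a ha
      have h3 := hfc a
      rwa [show (c - c') a = 0 from sub_eq_zero.2 (not_not.1 ha)] at h3
    have h3 := Set.ncard_le_ncard h2 (Set.toFinite _)
    have h4 := Set.ncard_add_ncard_compl {a | c a ≠ c' a}
    rw [Nat.card_fin] at h4
    omega
  · obtain ⟨M, hM⟩ := exists_isGeneratorMatrix _ hdim
    exact ⟨M, hM, fun a => ⟨_, hrepair M hM a⟩⟩
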